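/- Let $G$ be one of the groups $A_4$, $A_5$, $S_4$, acting faithfully on $M_2(\mathbb{C})$ by $\mathbb{C}$-algebra automorphisms (so that $G$ also acts on the Lie algebra $sl_2(\mathbb{C})$ of traceless matrices). Let $v_1=e_{11}-e_{22}$, $v_2=e_{12}$, $v_3=e_{21}$ be the standard basis of $sl_2(\mathbb{C})$, and let $J_0$ be the ideal of all elements of the group algebra $\mathbb{C}G$ that annihilate $sl_2(\mathbb{C})$. The free $G$-algebra $\mathbb{C}\langle X;G\rangle$ is the free associative unital algebra on the symbols $x_i^g$ ($i$ in a countably infinite index set, $g\in G$), with $G$ acting by $(x_i^{h})^g=x_i^{gh}$; $L\langle X;G\rangle$ is the Lie subalgebra of $\mathbb{C}\langle X;G\rangle^{(-)}$ generated by all $x_i^g$. For $z=\sum_g z_g g\in\mathbb{C}G$ put $z(x_i)=\sum_g z_g x_i^g$, and write $x_i=x_i^{1}$. A $G$-polynomial $f\in\mathbb{C}\langle X;G\rangle$ is a weak $G$-identity of the pair $(M_2(\mathbb{C}),sl_2(\mathbb{C}))$ if it vanishes under every substitution $x_i^g\mapsto g(a_i)$ with all $a_i\in sl_2(\mathbb{C})$.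 A weak $G$-ideal is a two-sided ideal of $\mathbb{C}\langle X;G\rangle$ invariant under all algebra endomorphisms of $\mathbb{C}\langle X;G\rangle$ that commute with the action of $G$ and map $L\langle X;G\rangle$ into itself. A set $S$ of $G$-polynomials is a basis of the weak $G$-identities of the pair if the set of all weak $G$-identities of the pair is the least weak $G$-ideal containing $S$. **Theorem.** There is a unique family $(\epsilon_{ij})_{1\le i,j\le 3}$ of elements of $\mathbb{C}G$ such that all $\epsilon_{ij}$ lie in a two-sided ideal $J_1$ with $\mathbb{C}G=J_0\oplus J_1$, and $\epsilon_{ij}(v_k)=\delta_{jk}v_i$ for all $i,j,k$. These elements are matrix units, that is, $\epsilon_{ij}\epsilon_{kl}=\delta_{jk}\epsilon_{il}$, and the following $G$-polynomials (a relation $p=q$ stands for $p-q$) form a basis of the weak $G$-identities of the pair $(M_2(\mathbb{C}),sl_2(\mathbb{C}))$: 1. $\epsilon_{11}(x_1)+\epsilon_{22}(x_1)+\epsilon_{33}(x_1)=x_1$; 2. $[\epsilon_{1\alpha}(x_1),\epsilon_{1\beta}(x_2)]=0$ for $\alpha,\beta\in\{1,2,3\}$; 3. $\epsilon_{1\alpha}(x_1)\epsilon_{ij}(x_2)+\epsilon_{ij}(x_2)\epsilon_{1\alpha}(x_1)=0$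 for $i\in\{2,3\}$ and $j,\alpha\in\{1,2,3\}$; 4. $\epsilon_{i\alpha}(x_1)\epsilon_{j\beta}(x_2)\epsilon_{i\gamma}(x_3)=\epsilon_{1\alpha}(x_1)\epsilon_{1\beta}(x_2)\epsilon_{i\gamma}(x_3)$ for $i,j\in\{2,3\}$, $i\ne j$, and $\alpha,\beta,\gamma\in\{1,2,3\}$; 5. $\epsilon_{i\alpha}(x_1)\epsilon_{i\beta}(x_2)=0$ for $i\in\{2,3\}$ and $\alpha,\beta\in\{1,2,3\}$; 6. $\epsilon_{3\alpha}(x_1)\epsilon_{2\beta}(x_2)+\epsilon_{2\beta}(x_2)\epsilon_{3\alpha}(x_1)=\epsilon_{1\alpha}(x_1)\epsilon_{1\beta}(x_2)$ for $\alpha,\beta\in\{1,2,3\}$; 7. $\epsilon_{1\alpha}(x_1)\epsilon_{j\beta}(x_2)=\epsilon_{1\beta}(x_2)\epsilon_{j\alpha}(x_1)$ for $j\in\{2,3\}$ and $\alpha,\beta\in\{1,2,3\}$; 8. $\epsilon_{2\alpha}(x_1)\epsilon_{3\beta}(x_2)=\epsilon_{2\beta}(x_2)\epsilon_{3\alpha}(x_1)$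 for $\alpha,\beta\in\{1,2,3\}$. -/

import Mathlib

namespace WeakGIdentities

noncomputable section

attribute [local instance 100] LieRing.ofAssociativeRing

/-- The algebra `M₂(ℂ)`. -/
abbrev M2 : Type := Matrix (Fin 2) (Fin 2) ℂ

/-- The Lie algebra `sl₂(ℂ)` of traceless matrices, as a Lie subalgebra of `M₂(ℂ)` with the
commutator bracket. -/
abbrev sl2 : LieSubalgebra ℂ M2 := LieAlgebra.SpecialLinear.sl (Fin 2) ℂ

/-- The basis `v₁ = e₁₁ - e₂₂`, `v₂ = e₁₂`, `v₃ = e₂₁` of `sl₂(ℂ)` (indexed from `0`). -/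
def v : Fin 3 → M2 := ![!![1, 0; 0, -1], !![0, 1; 0, 0], !![0, 0; 1, 0]]

variable {G : Type*} [Group G]

/-- The free associative unital `G`-algebra `ℂ⟨X; G⟩`: the free algebra on the symbols `xᵢ^g`,
`i ∈ ℕ`, `g ∈ G`. Here `(i, g)` stands for `xᵢ^g`. -/
abbrev FreeGAlgebra (G : Type*) : Type _ := FreeAlgebra ℂ (ℕ × G)

/-- The variable `xᵢ^g`. -/
abbrev X (i : ℕ) (g : G) : FreeGAlgebra G := FreeAlgebra.ι ℂ (i, g)

/-- The action of `G` on `ℂ⟨X; G⟩` by algebra endomorphisms: `g` sends `xᵢ^h` to `xᵢ^(gh)`. -/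
def gAct (g : G) : FreeGAlgebra G →ₐ[ℂ] FreeGAlgebra G :=
  FreeAlgebra.lift ℂ fun p : ℕ × G => X p.1 (g * p.2)

/-- The free Lie `G`-algebra `L⟨X; G⟩`: the Lie subalgebra of `ℂ⟨X; G⟩` (with the commutator
bracket) generated by all the variables `xᵢ^g`. -/
def freeLie (G : Type*) : LieSubalgebra ℂ (FreeGAlgebra G) :=
  LieSubalgebra.lieSpan ℂ (FreeGAlgebra G) (Set.range (FreeAlgebra.ι ℂ))

/-- An algebra endomorphism of `ℂ⟨X; G⟩` is an endomorphism of the `G`-pair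
`(ℂ⟨X; G⟩, L⟨X; G⟩)` if it commutes with the action of `G` and maps `L⟨X; G⟩` into itself. -/
def IsPairEndomorphism (θ : FreeGAlgebra G →ₐ[ℂ] FreeGAlgebra G) : Prop :=
  (∀ (g : G) (f : FreeGAlgebra G), θ (gAct g f) = gAct g (θ f)) ∧
    ∀ f ∈ freeLie G, θ f ∈ freeLie G

/-- A weak `G`-ideal: a two-sided ideal of `ℂ⟨X; G⟩` invariant under all endomorphisms of the
`G`-pair `(ℂ⟨X; G⟩, L⟨X; G⟩)`. -/
def IsWeakGIdeal (I : TwoSidedIdeal (FreeGAlgebra G)) : Prop :=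
  ∀ θ : FreeGAlgebra G →ₐ[ℂ] FreeGAlgebra G, IsPairEndomorphism θ → ∀ f ∈ I, θ f ∈ I

/-- Given an action `φ` of `G` on `M₂(ℂ)`, evaluation of `G`-polynomials at `xᵢ = aᵢ`;
the variable `xᵢ^g` is sent to `g(aᵢ)`. -/
def eval (φ : G →* (M2 ≃ₐ[ℂ] M2)) (a : ℕ → M2) : FreeGAlgebra G →ₐ[ℂ] M2 :=
  FreeAlgebra.lift ℂ fun p : ℕ × G => φ p.2 (a p.1)

/-- The ideal of weak `G`-identities of the pair `(M₂(ℂ), sl₂(ℂ))`: the `G`-polynomials which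
vanish whenever the variables are replaced by elements of `sl₂(ℂ)`. -/
def weakIdentities (φ : G →* (M2 ≃ₐ[ℂ] M2)) : TwoSidedIdeal (FreeGAlgebra G) :=
  ⨅ a : ℕ → sl2, TwoSidedIdeal.ker (eval φ fun i => (a i : M2))

theorem mem_weakIdentities (φ : G →* (M2 ≃ₐ[ℂ] M2)) (f : FreeGAlgebra G) :
    f ∈ weakIdentities φ ↔ ∀ a : ℕ → M2, (∀ i, a i ∈ sl2) → eval φ a f = 0 := by
  simp only [weakIdentities, TwoSidedIdeal.mem_iInf, TwoSidedIdeal.mem_ker]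
  exact ⟨fun h a ha => h fun i => ⟨a i, ha i⟩, fun h a => h _ fun i => (a i).2⟩

/-- A set `S` of `G`-polynomials is a basis of the weak `G`-identities of `(M₂(ℂ), sl₂(ℂ))` if
the ideal of weak `G`-identities is the least weak `G`-ideal containing `S`. -/
def IsBasisOfWeakIdentities (φ : G →* (M2 ≃ₐ[ℂ] M2)) (S : Set (FreeGAlgebra G)) : Prop :=
  IsLeast {I : TwoSidedIdeal (FreeGAlgebra G) | IsWeakGIdeal I ∧ S ⊆ (I : Set (FreeGAlgebra G))}
    (weakIdentities φ)

/-- The action of the group algebra `ℂG` on `M₂(ℂ)` extending linearly the action of `G`. -/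
def groupAlgebraAct (φ : G →* (M2 ≃ₐ[ℂ] M2)) : MonoidAlgebra ℂ G →ₐ[ℂ] Module.End ℂ M2 :=
  MonoidAlgebra.lift ℂ (Module.End ℂ M2) G ((AlgEquiv.toLinearMapHom ℂ M2).comp φ)

/-- `ε` is the system of matrix units `εᵢⱼ` of the copy of `M₃(ℂ)` in `ℂG`: one has
`ℂG = J₀ ⊕ J₁` with two-sided ideals `J₀` and `J₁`, where `J₀` consists of all the elements that
annihilate `sl₂(ℂ)`, and `εᵢⱼ` is an element of `J₁` that acts on `sl₂(ℂ)` by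
`εᵢⱼ(vₖ) = δⱼₖ vᵢ`. -/
def IsEpsilon (φ : G →* (M2 ≃ₐ[ℂ] M2)) (ε : Fin 3 → Fin 3 → MonoidAlgebra ℂ G) : Prop :=
  ∃ J₀ J₁ : TwoSidedIdeal (MonoidAlgebra ℂ G),
    (∀ z, z ∈ J₀ ↔ ∀ x ∈ sl2, groupAlgebraAct φ z x = 0) ∧ IsCompl J₀ J₁ ∧
      (∀ i j, ε i j ∈ J₁) ∧
      ∀ i j k, groupAlgebraAct φ (ε i j) (v k) = if j = k then v i else 0

/-- For `z = ∑ z_g g` in `ℂG`, the `G`-polynomial `z(xᵢ) = ∑ z_g xᵢ^g`. -/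
def opVar (z : MonoidAlgebra ℂ G) (i : ℕ) : FreeGAlgebra G :=
  z.coeff.sum fun g c => c • X i g

/-- The eight families of `G`-polynomials. The indices `1, 2, 3` are written `0, 1, 2` here,
so that `i ∈ {2, 3}` becomes `i ≠ 0`, and the relation `p = q` is recorded as `p - q`. -/
inductive IsListed (ε : Fin 3 → Fin 3 → MonoidAlgebra ℂ G) : FreeGAlgebra G → Prop
  | one : IsListed ε (opVar (ε 0 0) 1 + opVar (ε 1 1) 1 + opVar (ε 2 2) 1 - X 1 1)
  | two (α β : Fin 3) : IsListed ε
      (opVar (ε 0 α) 1 * opVar (ε 0 β) 2 - opVar (ε 0 β) 2 * opVar (ε 0 α) 1)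
  | three (α i j : Fin 3) (hi : i ≠ 0) : IsListed ε
      (opVar (ε 0 α) 1 * opVar (ε i j) 2 + opVar (ε i j) 2 * opVar (ε 0 α) 1)
  | four (i j α β γ : Fin 3) (hi : i ≠ 0) (hj : j ≠ 0) (hij : i ≠ j) : IsListed ε
      (opVar (ε i α) 1 * opVar (ε j β) 2 * opVar (ε i γ) 3
        - opVar (ε 0 α) 1 * opVar (ε 0 β) 2 * opVar (ε i γ) 3)
  | five (i α β : Fin 3) (hi : i ≠ 0) : IsListed ε (opVar (ε i α) 1 * opVar (ε i β) 2)
  | six (α β : Fin 3) : IsListed ε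
      (opVar (ε 2 α) 1 * opVar (ε 1 β) 2 + opVar (ε 1 β) 2 * opVar (ε 2 α) 1
        - opVar (ε 0 α) 1 * opVar (ε 0 β) 2)
  | seven (j α β : Fin 3) (hj : j ≠ 0) : IsListed ε
      (opVar (ε 0 α) 1 * opVar (ε j β) 2 - opVar (ε 0 β) 2 * opVar (ε j α) 1)
  | eight (α β : Fin 3) : IsListed ε
      (opVar (ε 1 α) 1 * opVar (ε 2 β) 2 - opVar (ε 1 β) 2 * opVar (ε 2 α) 1)

end

end WeakGIdentities

/-!
`G` contains a nontrivial Klein four-group whose involutions are permuted cyclically by some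
element of `G`. In a representation in which one of the involutions acts nontrivially this
produces three different joint eigenvalues, so the dimension is at least `3`, and `sl₂(ℂ)` is an
irreducible representation. By Burnside's theorem `ℂG → End(sl₂(ℂ)) = M₃(ℂ)` is surjective. Its
kernel `J₀` has a complement `J₁` because `ℂG` is semisimple, the complement is unique because
`J₀ J₁ = 0`, and `J₁` is a copy of `M₃(ℂ)`, with matrix units `εᵢⱼ`.

Modulo relation (1), each variable `xₘ^g` is a linear combination of the elements `εᵢⱼ(xₘ)`,
which take the values `t (m, j) • vᵢ` with arbitrary scalars `t (m, j)`. Modulo the relations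
(2)–(8), a product of such elements depends only on the multiset of the pairs `(m, j)` and,
linearly, on the product of the matrices `vᵢ`. So a polynomial lies in the ideal as soon as its
matrix value vanishes for each multiset separately, and this holds for an identity: distinct
monomials in the `t (m, j)` are distinct characters of a multiplicative monoid, hence linearly
independent.
-/

namespace WeakGIdentities

noncomputable section

attribute [local instance 100] LieRing.ofAssociativeRing

section TwoSidedIdeals

variable {R : Type*} [Ring R]

theorem mul_eq_zero_of_disjoint {I J : TwoSidedIdeal R} (h : Disjoint I J) {x y : R} (hx : x ∈ I)
    (hy : y ∈ J) : x * y = 0 :=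
  (TwoSidedIdeal.mem_bot R).1 <| h.le_bot <| (TwoSidedIdeal.mem_inf R).2
    ⟨I.mul_mem_right x y hx, J.mul_mem_left x y hy⟩

theorem le_of_disjoint_of_codisjoint {I J K : TwoSidedIdeal R} (hJ : Disjoint I J)
    (hK : Codisjoint I K) : J ≤ K := by
  intro x hx
  have h1 : (1 : R) ∈ I ⊔ K := by rw [hK.eq_top]; trivial
  obtain ⟨a, ha, b, hb, hab⟩ := TwoSidedIdeal.mem_sup.1 h1
  rw [← one_mul x, ← hab, add_mul, mul_eq_zero_of_disjoint hJ ha hx, zero_add]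
  exact K.mul_mem_right _ _ hb

theorem isCompl_right_unique {I J K : TwoSidedIdeal R} (hJ : IsCompl I J) (hK : IsCompl I K) :
    J = K :=
  le_antisymm (le_of_disjoint_of_codisjoint hJ.disjoint hK.codisjoint)
    (le_of_disjoint_of_codisjoint hK.disjoint hJ.codisjoint)

instance complementedLattice_twoSidedIdeal [IsSemisimpleRing R] :
    ComplementedLattice (TwoSidedIdeal R) :=
  let e : {I : Ideal R // I.IsTwoSided} ≃o fullyInvariantSubmodule R R :=
    { Equiv.subtypeEquivRight fun _ => isFullyInvariant_iff_isTwoSided.symm with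
      map_rel_iff' := Iff.rfl }
  OrderIso.complementedLattice
    (OrderIso.setIsotypicComponents.trans (e.symm.trans TwoSidedIdeal.orderIsoIsTwoSided.symm))

theorem injOn_of_disjoint_ker {S F : Type*} [Ring S] [FunLike F R S] [RingHomClass F R S] {f : F}
    {J : TwoSidedIdeal R} (hJ : Disjoint (TwoSidedIdeal.ker f) J) : Set.InjOn f J := by
  intro x hx y hy hxy
  have hker : x - y ∈ TwoSidedIdeal.ker f := by
    rw [TwoSidedIdeal.mem_ker, map_sub, hxy, sub_self]
  exact sub_eq_zero.1 <| (TwoSidedIdeal.mem_bot R).1 <| hJ.le_bot <| (TwoSidedIdeal.mem_inf R).2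
    ⟨hker, J.sub_mem hx hy⟩

theorem exists_mem_apply_eq_of_codisjoint_ker {S F : Type*} [Ring S] [FunLike F R S]
    [RingHomClass F R S] {f : F} (hf : Function.Surjective f) {J : TwoSidedIdeal R}
    (hJ : Codisjoint (TwoSidedIdeal.ker f) J) (y : S) : ∃ x ∈ J, f x = y := by
  obtain ⟨z, rfl⟩ := hf y
  have hz : z ∈ TwoSidedIdeal.ker f ⊔ J := by rw [hJ.eq_top]; trivial
  obtain ⟨a, ha, x, hx, rfl⟩ := TwoSidedIdeal.mem_sup.1 hz
  exact ⟨x, hx, by rw [map_add, (TwoSidedIdeal.mem_ker f).1 ha, zero_add]⟩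

end TwoSidedIdeals

theorem lsmul_surjective_of_isSimpleModule (k A V : Type*) [Field k] [IsAlgClosed k] [Ring A]
    [Algebra k A] [AddCommGroup V] [Module k V] [Module A V] [IsScalarTower k A V]
    [FiniteDimensional k V] [IsSimpleModule A V] :
    Function.Surjective (Algebra.lsmul k k V : A →ₐ[k] Module.End k V) := by
  intro f
  let F : Module.End (Module.End A V) V :=
    { f with
      map_smul' := fun d x => by
        obtain ⟨c, rfl⟩ := (IsSimpleModule.algebraMap_end_bijective_of_isAlgClosed k).2 d
        simp }
  have : Module.Finite (Module.End A V) V := .of_restrictScalars_finite k _ _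
  obtain ⟨r, hr⟩ := Module.Finite.toModuleEnd_moduleEnd_surjective F
  exact ⟨r, LinearMap.ext fun x => LinearMap.congr_fun hr x⟩

section Representations

variable {k G V : Type*} [Field k] [Group G] [AddCommGroup V] [Module k V]

theorem asAlgebraHom_surjective_of_isIrreducible {G : Type*} [Monoid G] [IsAlgClosed k]
    [FiniteDimensional k V] (ρ : Representation k G V) [ρ.IsIrreducible] :
    Function.Surjective ρ.asAlgebraHom := by
  intro f
  have : FiniteDimensional k ρ.asModule := ‹FiniteDimensional k V›
  obtain ⟨z, hz⟩ := lsmul_surjective_of_isSimpleModule k (MonoidAlgebra k G) ρ.asModule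
    (ρ.asModuleEquiv.symm.conj f)
  refine ⟨z, LinearMap.ext fun x => ?_⟩
  simpa [ρ.asModuleEquiv_map_smul] using
    congrArg ρ.asModuleEquiv (LinearMap.congr_fun hz (ρ.asModuleEquiv.symm x))

/-- `a` and `b` generate a Klein four-group (or a quotient of it) whose elements `a`, `b`, `ab` are
permuted cyclically by conjugation with `c`. -/
structure IsKleinTriple (a b c : G) : Prop where
  mul_self : a * a = 1
  mul_left : c * a = b * c
  mul_right : c * b = a * b * c

namespace IsKleinTriple

variable {a b c : G}

theorem map {H F : Type*} [Group H] [FunLike F G H] [MonoidHomClass F G H] (h : IsKleinTriple a b c)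
    (f : F) : IsKleinTriple (f a) (f b) (f c) where
  mul_self := by rw [← map_mul, h.mul_self, map_one]
  mul_left := by rw [← map_mul, h.mul_left, map_mul]
  mul_right := by rw [← map_mul, h.mul_right, map_mul, map_mul]

theorem right_mul_self (h : IsKleinTriple a b c) : b * b = 1 :=
  mul_right_cancel (b := c) <| by
    rw [mul_assoc, ← h.mul_left, ← mul_assoc, ← h.mul_left, mul_assoc, h.mul_self, mul_one, one_mul]

theorem mul_comm (h : IsKleinTriple a b c) : a * b = b * a := by
  have hab : a * b * (a * b) = 1 := mul_right_cancel (b := c) <| by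
    rw [mul_assoc, ← h.mul_right, ← mul_assoc, ← h.mul_right, mul_assoc, h.right_mul_self, mul_one,
      one_mul]
  rw [eq_inv_of_mul_eq_one_left hab, mul_inv_rev, inv_eq_of_mul_eq_one_left h.mul_self,
    inv_eq_of_mul_eq_one_left h.right_mul_self]

theorem apply_right (h : IsKleinTriple a b c) (ρ : Representation k G V) {α β : k} {x : V}
    (hα : α * α = 1) (ha : ρ a x = α • x) (hb : ρ b x = β • x) :
    ρ a (ρ c x) = (α * β) • ρ c x ∧ ρ b (ρ c x) = α • ρ c x := by
  have hbc : ρ b (ρ c x) = α • ρ c x := by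
    rw [← Module.End.mul_apply, ← map_mul, ← h.mul_left, map_mul, Module.End.mul_apply, ha,
      map_smul]
  refine ⟨?_, hbc⟩
  have habc : ρ a (ρ b (ρ c x)) = β • ρ c x := by
    rw [← Module.End.mul_apply, ← Module.End.mul_apply, ← map_mul, ← map_mul, ← h.mul_right,
      map_mul, Module.End.mul_apply, hb, map_smul]
  rw [mul_smul, ← habc, hbc, map_smul, smul_smul, hα, one_smul]

theorem exists_jointEigenvector (h : IsKleinTriple a b c) {ρ : Representation k G V}
    (ha : ρ a ≠ 1) : ∃ x ≠ 0, ρ a x = (-1 : k) • x ∧ ρ b x = (1 : k) • x := by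
  obtain ⟨x, hx, hax⟩ : ∃ x ≠ 0, ρ a x = (-1 : k) • x := by
    obtain ⟨x, hx⟩ : ∃ x, ρ a x ≠ x := by
      by_contra! hx
      exact ha (LinearMap.ext hx)
    refine ⟨ρ a x - x, sub_ne_zero.2 hx, ?_⟩
    rw [map_sub, ← Module.End.mul_apply, ← map_mul, h.mul_self, map_one, Module.End.one_apply,
      neg_one_smul, neg_sub]
  by_cases hbx : ρ b x = (-1 : k) • x
  · obtain ⟨hac, hbc⟩ := h.apply_right ρ (by simp) hax hbx
    obtain ⟨hacc, hbcc⟩ := h.apply_right ρ (by simp) hac hbc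
    have hc (y : V) : ρ c y = 0 ↔ y = 0 := map_eq_zero_iff _ (ρ.apply_bijective c).1
    exact ⟨ρ c (ρ c x), by simpa [hc] using hx, by simpa using hacc, by simpa using hbcc⟩
  · have hab : ρ a (ρ b x) = -ρ b x := by
      rw [← Module.End.mul_apply, ← map_mul, h.mul_comm, map_mul, Module.End.mul_apply, hax,
        map_smul, neg_one_smul]
    have hbb : ρ b (ρ b x) = x := by
      rw [← Module.End.mul_apply, ← map_mul, h.right_mul_self, map_one, Module.End.one_apply]
    refine ⟨x + ρ b x, fun h0 => hbx ?_, ?_, ?_⟩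
    · rw [neg_one_smul, eq_neg_of_add_eq_zero_right h0]
    · rw [map_add, hax, hab, neg_one_smul, neg_one_smul, neg_add]
    · rw [map_add, hbb, one_smul, add_comm]

theorem three_le_finrank (h : IsKleinTriple a b c) [NeZero (2 : k)] [FiniteDimensional k V]
    {ρ : Representation k G V} (ha : ρ a ≠ 1) : 3 ≤ Module.finrank k V := by
  obtain ⟨x, hx, hax, hbx⟩ := h.exists_jointEigenvector ha
  obtain ⟨hac, hbc⟩ := h.apply_right ρ (by simp) hax hbx
  obtain ⟨hacc, hbcc⟩ := h.apply_right ρ (by simp) hac hbc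
  have hμ : Function.Injective (![1, -3, -1] : Fin 3 → k) := by
    have h2 : (2 : k) ≠ 0 := two_ne_zero
    have h13 : (1 : k) ≠ -3 := fun h => mul_ne_zero h2 h2 (by linear_combination h)
    have h11 : (1 : k) ≠ -1 := fun h => h2 (by linear_combination h)
    have h31 : (3 : k) ≠ 1 := fun h => h2 (by linear_combination h)
    intro i j hij
    fin_cases i <;> fin_cases j <;>
      simp [h13, h11, h31, h13.symm, h11.symm, h31.symm] at hij ⊢
  -- The factor `2` separates the joint eigenvalues `(-1, 1)`, `(-1, -1)`, `(1, -1)` of `a`, `b`.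
  have hv (i : Fin 3) : Module.End.HasEigenvector (ρ a + (2 : k) • ρ b) (![1, -3, -1] i)
      (![x, ρ c x, ρ c (ρ c x)] i) := by
    refine Module.End.hasEigenvector_iff.2 ⟨Module.End.mem_eigenspace_iff.2 ?_, ?_⟩
    · fin_cases i
      · change ρ a x + (2 : k) • ρ b x = (1 : k) • x
        rw [hax, hbx]; module
      · change ρ a (ρ c x) + (2 : k) • ρ b (ρ c x) = (-3 : k) • ρ c x
        rw [hac, hbc]; module
      · change ρ a (ρ c (ρ c x)) + (2 : k) • ρ b (ρ c (ρ c x)) = (-1 : k) • ρ c (ρ c x)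
        rw [hacc, hbcc]; module
    · have hc (y : V) : ρ c y = 0 ↔ y = 0 := map_eq_zero_iff _ (ρ.apply_bijective c).1
      fin_cases i <;> simpa [hc] using hx
  simpa using (Module.End.eigenvectors_linearIndependent' _ _ hμ _ hv).fintype_card_le_finrank

end IsKleinTriple

theorem isIrreducible_of_isKleinTriple [NeZero (2 : k)] {a b c : G} (h : IsKleinTriple a b c)
    (hV : Module.finrank k V = 3) {ρ : Representation k G V} (ha : ρ a ≠ 1) :
    ρ.IsIrreducible := by
  have : FiniteDimensional k V := .of_finrank_pos (by lia)
  have : Nontrivial V := Module.nontrivial_of_finrank_pos (R := k) (by lia)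
  have : Nontrivial (Subrepresentation ρ) :=
    ⟨⊥, ⊤, fun h => bot_ne_top (congrArg Subrepresentation.toSubmodule h)⟩
  refine { eq_bot_or_eq_top := fun W => ?_ }
  by_contra! hW
  have hbot : W.toSubmodule ≠ ⊥ := fun h => hW.1 (Subrepresentation.toSubmodule_injective h)
  have htop : W.toSubmodule ≠ ⊤ := fun h => hW.2 (Subrepresentation.toSubmodule_injective h)
  have hsub : W.toRepresentation a = 1 := by
    by_contra hne
    have := h.three_le_finrank hne
    have := Submodule.finrank_lt htop
    lia
  have hquot : ρ.quotient W.toSubmodule W.apply_mem_toSubmodule a = 1 := by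
    by_contra hne
    have := h.three_le_finrank hne
    have := W.toSubmodule.finrank_quotient_add_finrank
    have := Submodule.one_le_finrank_iff.2 hbot
    lia
  refine ha (LinearMap.ext fun x => ?_)
  have hx : ρ a x - x ∈ W.toSubmodule :=
    (Submodule.Quotient.eq _).1 (LinearMap.congr_fun hquot (Submodule.Quotient.mk x))
  have hneg : ρ a (ρ a x - x) = ρ a x - x :=
    congrArg Subtype.val (LinearMap.congr_fun hsub ⟨_, hx⟩)
  rw [map_sub, ← Module.End.mul_apply, ← map_mul, h.mul_self, map_one, Module.End.one_apply]
    at hneg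
  have h2 : (2 : k) • (ρ a x - x) = 0 := by
    rw [two_smul, ← eq_neg_iff_add_eq_zero, neg_sub, hneg]
  exact sub_eq_zero.1 ((smul_eq_zero.1 h2).resolve_left two_ne_zero)

end Representations

section Groups

variable {G H : Type*} [Group G] [Group H]

theorem exists_isKleinTriple_of_injective {f : H →* G} (hf : Function.Injective f)
    (hH : ∃ a b c : H, IsKleinTriple a b c ∧ a ≠ 1) :
    ∃ a b c : G, IsKleinTriple a b c ∧ a ≠ 1 := by
  obtain ⟨a, b, c, h, ha⟩ := hH
  exact ⟨f a, f b, f c, h.map f, (map_ne_one_iff f hf).2 ha⟩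

theorem exists_isKleinTriple_alternatingGroup_fin_four :
    ∃ a b c : alternatingGroup (Fin 4), IsKleinTriple a b c ∧ a ≠ 1 :=
  ⟨⟨.swap 0 1 * .swap 2 3, Equiv.Perm.mem_alternatingGroup.2 (by decide)⟩,
    ⟨.swap 0 2 * .swap 1 3, Equiv.Perm.mem_alternatingGroup.2 (by decide)⟩,
    ⟨.swap 1 2 * .swap 2 3, Equiv.Perm.mem_alternatingGroup.2 (by decide)⟩,
    ⟨by decide, by decide, by decide⟩, by decide⟩

theorem exists_isKleinTriple_alternatingGroup {α : Type*} [Fintype α] [DecidableEq α]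
    (hα : 4 ≤ Fintype.card α) : ∃ a b c : alternatingGroup α, IsKleinTriple a b c ∧ a ≠ 1 := by
  obtain ⟨s, -, hs⟩ := Finset.exists_subset_card_eq (s := Finset.univ) hα
  let e : Fin 4 ≃ s := (s.equivFinOfCardEq hs).symm
  refine exists_isKleinTriple_of_injective (f := (alternatingGroup.ofSubtype s).comp
    (Equiv.altCongrHom e).toMonoidHom) ?_ exists_isKleinTriple_alternatingGroup_fin_four
  exact alternatingGroup.ofSubtype_injective.comp (Equiv.altCongrHom e).injective

theorem exists_isKleinTriple
    (hG : Nonempty (G ≃* alternatingGroup (Fin 4)) ∨ Nonempty (G ≃* alternatingGroup (Fin 5)) ∨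
      Nonempty (G ≃* Equiv.Perm (Fin 4))) : ∃ a b c : G, IsKleinTriple a b c ∧ a ≠ 1 := by
  rcases hG with ⟨⟨e⟩⟩ | ⟨⟨e⟩⟩ | ⟨⟨e⟩⟩
  · exact exists_isKleinTriple_of_injective (f := e.symm.toMonoidHom) e.symm.injective
      (exists_isKleinTriple_alternatingGroup (by simp))
  · exact exists_isKleinTriple_of_injective (f := e.symm.toMonoidHom) e.symm.injective
      (exists_isKleinTriple_alternatingGroup (by simp))
  · exact exists_isKleinTriple_of_injective
      (f := e.symm.toMonoidHom.comp (alternatingGroup (Fin 4)).subtype)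
      (e.symm.injective.comp Subtype.val_injective)
      (exists_isKleinTriple_alternatingGroup (by simp))

theorem finite_of_mulEquiv
    (hG : Nonempty (G ≃* alternatingGroup (Fin 4)) ∨ Nonempty (G ≃* alternatingGroup (Fin 5)) ∨
      Nonempty (G ≃* Equiv.Perm (Fin 4))) : Finite G := by
  rcases hG with ⟨⟨e⟩⟩ | ⟨⟨e⟩⟩ | ⟨⟨e⟩⟩ <;> exact Finite.of_equiv _ e.symm.toEquiv

end Groups

section SpecialLinear

variable {G : Type*} [Group G]

/-- The three entries of a matrix which are its coordinates in the basis `v` if it is traceless. -/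
def coord : Fin 3 → M2 →ₗ[ℂ] ℂ :=
  ![Matrix.entryLinearMap ℂ ℂ 0 0, Matrix.entryLinearMap ℂ ℂ 0 1, Matrix.entryLinearMap ℂ ℂ 1 0]

theorem mem_sl2_iff (x : M2) : x ∈ sl2 ↔ x.trace = 0 :=
  Iff.rfl

theorem v_mem_sl2 (i : Fin 3) : v i ∈ sl2 := by
  rw [mem_sl2_iff, Matrix.trace_fin_two]
  fin_cases i <;> simp [v]

theorem coord_v (i j : Fin 3) : coord i (v j) = if i = j then 1 else 0 := by
  fin_cases i <;> fin_cases j <;> simp [v, coord]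

theorem sum_coord_smul_v {x : M2} (hx : x ∈ sl2) : ∑ i, coord i x • v i = x := by
  rw [mem_sl2_iff, Matrix.trace_fin_two, add_comm, add_eq_zero_iff_eq_neg] at hx
  ext i j
  fin_cases i <;> fin_cases j <;> simp [v, coord, Fin.sum_univ_three, hx]

/-- The vectors `v` as a basis of `sl₂(ℂ)`. -/
def sl2Basis : Module.Basis (Fin 3) ℂ sl2 :=
  .ofEquivFun
    { toFun x i := coord i (x : M2)
      map_add' x y := by ext i; simp
      map_smul' c x := by ext i; simp
      invFun c := ∑ i, c i • ⟨v i, v_mem_sl2 i⟩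
      left_inv x := Subtype.ext <| by simpa using sum_coord_smul_v x.2
      right_inv c := funext fun i => by simp [coord_v] }

theorem coe_sl2Basis (i : Fin 3) : (sl2Basis i : M2) = v i := by
  simp [sl2Basis, Pi.single_apply]

/-- The representation of `G` on `sl₂(ℂ)`. -/
def sl2Rep (φ : G →* (M2 ≃ₐ[ℂ] M2)) : Representation ℂ G sl2 where
  toFun g := (φ g).toLinearMap.restrict fun x hx => (Matrix.trace_map (φ g) x).trans hx
  map_one' := by ext1 x; ext1; simp
  map_mul' g h := by ext1 x; ext1; rw [map_mul]; rfl

theorem coe_sl2Rep_apply (φ : G →* (M2 ≃ₐ[ℂ] M2)) (g : G) (x : sl2) :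
    (sl2Rep φ g x : M2) = φ g x :=
  rfl

theorem sl2Rep_injective {φ : G →* (M2 ≃ₐ[ℂ] M2)} (hφ : Function.Injective φ) :
    Function.Injective (sl2Rep φ) := by
  intro g h hgh
  refine hφ (AlgEquiv.ext fun x => ?_)
  have hx : x - (x.trace / 2) • (1 : M2) ∈ sl2 := by
    simp [mem_sl2_iff]
  have := congrArg Subtype.val (LinearMap.congr_fun hgh ⟨_, hx⟩)
  simpa [coe_sl2Rep_apply] using this

theorem coe_asAlgebraHom_sl2Rep_apply (φ : G →* (M2 ≃ₐ[ℂ] M2)) (z : MonoidAlgebra ℂ G)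
    (x : sl2) : ((sl2Rep φ).asAlgebraHom z x : M2) = groupAlgebraAct φ z x := by
  induction z using MonoidAlgebra.induction_on with
  | of g => simp [groupAlgebraAct, coe_sl2Rep_apply]
  | add a b ha hb => simp [ha, hb]
  | smul r a ha => simp [ha]

theorem groupAlgebraAct_mem_sl2 (φ : G →* (M2 ≃ₐ[ℂ] M2)) (z : MonoidAlgebra ℂ G) {x : M2}
    (hx : x ∈ sl2) : groupAlgebraAct φ z x ∈ sl2 :=
  coe_asAlgebraHom_sl2Rep_apply φ z ⟨x, hx⟩ ▸ Subtype.coe_prop _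

theorem mem_ker_asAlgebraHom_sl2Rep {φ : G →* (M2 ≃ₐ[ℂ] M2)} {z : MonoidAlgebra ℂ G} :
    z ∈ TwoSidedIdeal.ker (sl2Rep φ).asAlgebraHom ↔ ∀ x ∈ sl2, groupAlgebraAct φ z x = 0 := by
  simp only [TwoSidedIdeal.mem_ker, LinearMap.ext_iff, Subtype.ext_iff, Subtype.forall,
    coe_asAlgebraHom_sl2Rep_apply, LinearMap.zero_apply, ZeroMemClass.coe_zero]

end SpecialLinear

section MatrixUnits

variable {G : Type*} [Group G] {φ : G →* (M2 ≃ₐ[ℂ] M2)}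
  {ε : Fin 3 → Fin 3 → MonoidAlgebra ℂ G}

theorem isEpsilon_iff : IsEpsilon φ ε ↔
    ∃ J : TwoSidedIdeal (MonoidAlgebra ℂ G),
      IsCompl (TwoSidedIdeal.ker (sl2Rep φ).asAlgebraHom) J ∧ (∀ i j, ε i j ∈ J) ∧
        ∀ i j, (sl2Rep φ).asAlgebraHom (ε i j) =
          Matrix.toLinAlgEquiv sl2Basis (Matrix.single i j 1) := by
  have hact (i j : Fin 3) : (sl2Rep φ).asAlgebraHom (ε i j) =
      Matrix.toLinAlgEquiv sl2Basis (Matrix.single i j 1) ↔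
        ∀ k, groupAlgebraAct φ (ε i j) (v k) = if j = k then v i else 0 := by
    refine ⟨fun h k => ?_, fun h => sl2Basis.ext fun k => Subtype.ext ?_⟩
    · rw [← coe_sl2Basis, ← coe_asAlgebraHom_sl2Rep_apply, h, Matrix.toLinAlgEquiv_self]
      by_cases hjk : j = k <;> simp [Matrix.single_apply, coe_sl2Basis, hjk]
    · rw [coe_asAlgebraHom_sl2Rep_apply, coe_sl2Basis, h, Matrix.toLinAlgEquiv_self]
      by_cases hjk : j = k <;> simp [Matrix.single_apply, coe_sl2Basis, hjk]
  simp only [hact]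
  constructor
  · rintro ⟨J₀, J₁, hJ₀, h⟩
    obtain rfl : J₀ = TwoSidedIdeal.ker (sl2Rep φ).asAlgebraHom :=
      TwoSidedIdeal.ext fun z => (hJ₀ z).trans mem_ker_asAlgebraHom_sl2Rep.symm
    exact ⟨J₁, h⟩
  · rintro ⟨J₁, h⟩
    exact ⟨_, J₁, fun z => mem_ker_asAlgebraHom_sl2Rep, h⟩

theorem existsUnique_isEpsilon [Finite G] (hφ : (sl2Rep φ).IsIrreducible) :
    ∃! ε, IsEpsilon φ ε := by
  have : NeZero (Nat.card G : ℂ) := ⟨Nat.cast_ne_zero.2 Nat.card_pos.ne'⟩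
  have hsurj := asAlgebraHom_surjective_of_isIrreducible (sl2Rep φ)
  obtain ⟨J, hJ⟩ := exists_isCompl (TwoSidedIdeal.ker (sl2Rep φ).asAlgebraHom)
  choose s hsJ hs using exists_mem_apply_eq_of_codisjoint_ker hsurj hJ.codisjoint
  refine ⟨fun i j => s (Matrix.toLinAlgEquiv sl2Basis (Matrix.single i j 1)),
    isEpsilon_iff.2 ⟨J, hJ, fun i j => hsJ _, fun i j => hs _⟩, fun ε hε => ?_⟩
  obtain ⟨K, hK, hεK, hε⟩ := isEpsilon_iff.1 hε
  obtain rfl := isCompl_right_unique hJ hK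
  ext1 i
  ext1 j
  exact injOn_of_disjoint_ker hJ.disjoint (hεK i j) (hsJ _) ((hε i j).trans (hs _).symm)

namespace IsEpsilon

theorem apply (h : IsEpsilon φ ε) (i j : Fin 3) {x : M2} (hx : x ∈ sl2) :
    groupAlgebraAct φ (ε i j) x = coord j x • v i := by
  obtain ⟨_, _, _, _, _, hv⟩ := h
  conv_lhs => rw [← sum_coord_smul_v hx]
  simp [map_sum, hv]

theorem mul_eq (h : IsEpsilon φ ε) (i j k l : Fin 3) :
    ε i j * ε k l = if j = k then ε i l else 0 := by
  obtain ⟨J, hJ, hεJ, hε⟩ := isEpsilon_iff.1 h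
  split_ifs with hjk
  · subst hjk
    refine injOn_of_disjoint_ker hJ.disjoint (J.mul_mem_left _ _ (hεJ j l)) (hεJ i l) ?_
    rw [map_mul, hε, hε, hε, ← map_mul, Matrix.single_mul_single_same, one_mul]
  · refine injOn_of_disjoint_ker hJ.disjoint (J.mul_mem_left _ _ (hεJ k l)) J.zero_mem ?_
    rw [map_mul, hε, hε, map_zero, ← map_mul, Matrix.single_mul_single_of_ne _ _ _ _ hjk, map_zero]

theorem mul_right_eq_sum (h : IsEpsilon φ ε) (i k : Fin 3) (z : MonoidAlgebra ℂ G) :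
    ε i k * z = ∑ j, coord k (groupAlgebraAct φ z (v j)) • ε i j := by
  obtain ⟨J, hJ, hεJ, -⟩ := isEpsilon_iff.1 h
  have hsmul (c : ℂ) (j : Fin 3) : c • ε i j ∈ J := by
    rw [← one_mul (ε i j), ← smul_mul_assoc]
    exact J.mul_mem_left _ _ (hεJ i j)
  refine injOn_of_disjoint_ker hJ.disjoint (J.mul_mem_right _ _ (hεJ i k))
    (sum_mem fun j _ => hsmul _ j) (sl2Basis.ext fun m => Subtype.ext ?_)
  simp only [coe_asAlgebraHom_sl2Rep_apply, coe_sl2Basis, map_mul, Module.End.mul_apply,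
    h.apply i k (groupAlgebraAct_mem_sl2 φ z (v_mem_sl2 m))]
  simp [h.apply i _ (v_mem_sl2 m), coord_v]

end IsEpsilon

end MatrixUnits

section GenericRelations

variable {P Q : Type*} [Ring Q]

/-- The relations (2)–(8) of the theorem, for a family `y` in any ring in place of the elements
`εᵢⱼ(xₘ)`. They hold for the multiples `t p • v i` of the `v i`. -/
structure GenericRelations (y : Fin 3 → P → Q) : Prop where
  comm : ∀ p q, y 0 p * y 0 q = y 0 q * y 0 p
  anticomm : ∀ i, i ≠ 0 → ∀ p q, y i p * y 0 q = -(y 0 q * y i p)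
  triple : ∀ i j, i ≠ 0 → j ≠ 0 → i ≠ j → ∀ p q r,
    y i p * y j q * y i r = y 0 p * y 0 q * y i r
  sq : ∀ i, i ≠ 0 → ∀ p q, y i p * y i q = 0
  add : ∀ p q, y 2 p * y 1 q + y 1 q * y 2 p = y 0 p * y 0 q
  swap_zero : ∀ j, j ≠ 0 → ∀ p q, y 0 p * y j q = y 0 q * y j p
  swap_one_two : ∀ p q, y 1 p * y 2 q = y 1 q * y 2 p

theorem GenericRelations.swap_two_one {y : Fin 3 → P → Q} (h : GenericRelations y) (p q : P) :
    y 2 p * y 1 q = y 2 q * y 1 p := by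
  have h1 := h.add p q
  rw [h.comm, ← h.add q p, h.swap_one_two q p] at h1
  exact add_right_cancel h1

variable [Algebra ℂ Q]

/-- The linear map that sends a product `v i₁ * ⋯ * v iₙ` to `y i₁ p₁ * ⋯ * y iₙ pₙ`, for the list
`p₁, …, pₙ` and a family `y` satisfying `GenericRelations`. The values of products of one or two
of the `v i` force the first three cases; longer words begin with `v 0 * v 0 = 1`. -/
def normalForm (y : Fin 3 → P → Q) : List P → M2 →ₗ[ℂ] Q
  | [] => (Matrix.entryLinearMap ℂ ℂ 0 0).smulRight 1
  | [p] => (Matrix.entryLinearMap ℂ ℂ 0 0).smulRight (y 0 p) +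
      (Matrix.entryLinearMap ℂ ℂ 0 1).smulRight (y 1 p) +
      (Matrix.entryLinearMap ℂ ℂ 1 0).smulRight (y 2 p)
  | [p, q] => (Matrix.entryLinearMap ℂ ℂ 0 0).smulRight (y 1 p * y 2 q) +
      (Matrix.entryLinearMap ℂ ℂ 1 1).smulRight (y 2 p * y 1 q) +
      (Matrix.entryLinearMap ℂ ℂ 0 1).smulRight (y 0 p * y 1 q) -
      (Matrix.entryLinearMap ℂ ℂ 1 0).smulRight (y 0 p * y 2 q)
  | p :: q :: r :: l => LinearMap.mulLeft ℂ (y 0 p) ∘ₗ normalForm y (q :: r :: l) ∘ₗ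
      LinearMap.mulLeft ℂ (v 0)

section

variable (y : Fin 3 → P → Q)

theorem normalForm_nil (m : M2) : normalForm y [] m = m 0 0 • 1 := by
  simp [normalForm]

theorem normalForm_singleton (p : P) (m : M2) :
    normalForm y [p] m = m 0 0 • y 0 p + m 0 1 • y 1 p + m 1 0 • y 2 p := by
  simp [normalForm]

theorem normalForm_pair (p q : P) (m : M2) :
    normalForm y [p, q] m = m 0 0 • (y 1 p * y 2 q) + m 1 1 • (y 2 p * y 1 q) +
      m 0 1 • (y 0 p * y 1 q) - m 1 0 • (y 0 p * y 2 q) := by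
  simp [normalForm]

theorem normalForm_cons_cons_cons (p q r : P) (l : List P) (m : M2) :
    normalForm y (p :: q :: r :: l) m = y 0 p * normalForm y (q :: r :: l) (v 0 * m) :=
  rfl

end

theorem v_zero_mul_self : v 0 * v 0 = 1 := by
  ext i j; fin_cases i <;> fin_cases j <;> simp [v]

theorem v_mul_self (i : Fin 3) (hi : i ≠ 0) : v i * v i = 0 := by
  fin_cases i
  · exact absurd rfl hi
  all_goals ext k l; fin_cases k <;> fin_cases l <;> simp [v]

theorem v_mul_v_zero (i : Fin 3) (hi : i ≠ 0) : v i * v 0 = -(v 0 * v i) := by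
  fin_cases i
  · exact absurd rfl hi
  all_goals ext k l; fin_cases k <;> fin_cases l <;> simp [v]

theorem v_two_mul_v_one_add : v 2 * v 1 + v 1 * v 2 = v 0 * v 0 := by
  ext i j; fin_cases i <;> fin_cases j <;> simp [v]

theorem v_mul_mul_self (i j : Fin 3) (hi : i ≠ 0) (hj : j ≠ 0) (hij : i ≠ j) :
    v i * v j * v i = v i := by
  fin_cases i <;> fin_cases j <;> try contradiction
  all_goals ext k l; fin_cases k <;> fin_cases l <;> simp [v]

theorem genericRelations_smul_v (t : P → ℂ) : GenericRelations fun i p => t p • v i where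
  comm p q := by simp only [smul_mul_smul, mul_comm]
  anticomm i hi p q := by simp only [smul_mul_smul, v_mul_v_zero i hi, smul_neg, mul_comm]
  triple i j hi hj hij p q r := by
    simp only [smul_mul_smul, v_mul_mul_self i j hi hj hij, v_zero_mul_self, one_mul]
  sq i hi p q := by simp only [smul_mul_smul, v_mul_self i hi, smul_zero]
  add p q := by
    simp only [smul_mul_smul, mul_comm (t q), ← smul_add, v_two_mul_v_one_add]
  swap_zero j _ p q := by simp only [smul_mul_smul, mul_comm]
  swap_one_two p q := by simp only [smul_mul_smul, mul_comm]

namespace GenericRelations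

variable {y : Fin 3 → P → Q}

theorem normalForm_swap (h : GenericRelations y) (p q : P) (l : List P) :
    normalForm y (p :: q :: l) = normalForm y (q :: p :: l) := by
  ext1 m
  match l with
  | [] => rw [normalForm_pair, normalForm_pair, h.swap_one_two p q, h.swap_two_one p q,
      h.swap_zero 1 (by decide) p q, h.swap_zero 2 (by decide) p q]
  | [r] =>
    simp only [normalForm_cons_cons_cons, normalForm_pair, mul_add, mul_sub, mul_smul_comm,
      ← mul_assoc, h.swap_zero 1 (by decide) p q, h.swap_zero 2 (by decide) p q, h.comm p q]
  | r :: s :: l =>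
    simp only [normalForm_cons_cons_cons, ← mul_assoc, h.comm p q]

theorem normalForm_perm (h : GenericRelations y) {l l' : List P} (hl : l.Perm l') :
    normalForm y l = normalForm y l' := by
  induction hl with
  | nil => rfl
  | @cons p l₁ l₂ hp ih =>
    match l₁, l₂, hp.length_eq with
    | [], [], _ => rfl
    | [q], [r], _ => rw [List.singleton_perm_singleton.1 hp]
    | q :: r :: l₁, s :: t :: l₂, _ =>
      ext1 m
      rw [normalForm_cons_cons_cons, normalForm_cons_cons_cons, ih]
  | swap p q l => exact h.normalForm_swap q p l
  | trans _ _ ih₁ ih₂ => exact ih₁.trans ih₂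

theorem one_mul_normalForm_pair (h : GenericRelations y) (p q r : P) (m : M2) :
    y 1 p * normalForm y [q, r] m = normalForm y [p, q, r] (v 1 * m) := by
  have h12 : y 1 p * (y 1 q * y 2 r) = 0 := by
    rw [← mul_assoc, h.sq 1 (by decide), zero_mul]
  have h21 : y 1 p * (y 2 q * y 1 r) = y 0 p * (y 0 q * y 1 r) := by
    rw [← mul_assoc, ← mul_assoc, h.triple 1 2 (by decide) (by decide) (by decide)]
  have h01 : y 1 p * (y 0 q * y 1 r) = 0 := by
    rw [← mul_assoc, h.anticomm 1 (by decide), neg_mul, mul_assoc, h.sq 1 (by decide),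
      mul_zero, neg_zero]
  have h02 : y 1 p * (y 0 q * y 2 r) = -(y 0 p * (y 1 q * y 2 r)) := by
    rw [← mul_assoc, h.anticomm 1 (by decide), h.swap_zero 1 (by decide), neg_mul, mul_assoc]
  rw [normalForm_cons_cons_cons, normalForm_pair, normalForm_pair]
  simp [v, mul_add, mul_sub, Matrix.mul_apply, Matrix.vecMul, Matrix.vecHead, Matrix.vecTail,
    h12, h21, h01, h02, add_comm]

theorem two_mul_normalForm_pair (h : GenericRelations y) (p q r : P) (m : M2) :
    y 2 p * normalForm y [q, r] m = normalForm y [p, q, r] (v 2 * m) := by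
  have h21 : y 2 p * (y 2 q * y 1 r) = 0 := by
    rw [← mul_assoc, h.sq 2 (by decide), zero_mul]
  have h12 : y 2 p * (y 1 q * y 2 r) = y 0 p * (y 0 q * y 2 r) := by
    rw [← mul_assoc, ← mul_assoc, h.triple 2 1 (by decide) (by decide) (by decide)]
  have h02 : y 2 p * (y 0 q * y 2 r) = 0 := by
    rw [← mul_assoc, h.anticomm 2 (by decide), neg_mul, mul_assoc, h.sq 2 (by decide),
      mul_zero, neg_zero]
  have h01 : y 2 p * (y 0 q * y 1 r) = -(y 0 p * (y 2 q * y 1 r)) := by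
    rw [← mul_assoc, h.anticomm 2 (by decide), h.swap_zero 2 (by decide), neg_mul, mul_assoc]
  rw [normalForm_cons_cons_cons, normalForm_pair, normalForm_pair]
  simp [v, mul_add, mul_sub, Matrix.mul_apply, Matrix.vecMul, Matrix.vecHead, Matrix.vecTail,
    h12, h21, h01, h02, add_comm]

theorem mul_normalForm (h : GenericRelations y) (i : Fin 3) (p q r : P) (l : List P) (m : M2) :
    y i p * normalForm y (q :: r :: l) m = normalForm y (p :: q :: r :: l) (v i * m) := by
  by_cases hi : i = 0
  · subst hi
    rw [normalForm_cons_cons_cons, ← mul_assoc, v_zero_mul_self, one_mul]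
  induction l generalizing p q r m with
  | nil =>
    fin_cases i
    exacts [absurd rfl hi, h.one_mul_normalForm_pair p q r m, h.two_mul_normalForm_pair p q r m]
  | cons s l ih =>
    calc y i p * normalForm y (q :: r :: s :: l) m
        = -(y 0 q * (y i p * normalForm y (r :: s :: l) (v 0 * m))) := by
          rw [normalForm_cons_cons_cons, ← mul_assoc, h.anticomm i hi, neg_mul, mul_assoc]
      _ = y 0 q * normalForm y (p :: r :: s :: l) (v 0 * (v i * m)) := by
          rw [ih, ← mul_assoc, v_mul_v_zero i hi, neg_mul, map_neg, mul_neg, neg_neg, mul_assoc]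
      _ = normalForm y (p :: q :: r :: s :: l) (v i * m) := by
          rw [← normalForm_cons_cons_cons, h.normalForm_swap]

theorem mul_eq_normalForm (h : GenericRelations y) (i j : Fin 3) (p q : P) :
    y i p * y j q = normalForm y [p, q] (v i * v j) := by
  have h00 : y 0 p * y 0 q = y 1 p * y 2 q + y 2 p * y 1 q := by
    rw [← h.add, h.swap_one_two q p, add_comm]
  have h10 : y 1 p * y 0 q = -(y 0 p * y 1 q) := by
    rw [h.anticomm 1 (by decide), h.swap_zero 1 (by decide)]
  have h20 : y 2 p * y 0 q = -(y 0 p * y 2 q) := by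
    rw [h.anticomm 2 (by decide), h.swap_zero 2 (by decide)]
  have h11 := h.sq 1 (by decide) p q
  have h22 := h.sq 2 (by decide) p q
  rw [normalForm_pair]
  fin_cases i <;> fin_cases j <;> simp [v, h00, h10, h20, h11, h22]

theorem prod_eq_normalForm (h : GenericRelations y) : ∀ w : List (Fin 3 × P),
    (w.map fun a => y a.1 a.2).prod =
      normalForm y (w.map Prod.snd) (w.map fun a => v a.1).prod
  | [] => by simp [normalForm_nil]
  | [(i, p)] => by fin_cases i <;> simp [normalForm_singleton, v]
  | [a, b] => by simpa using h.mul_eq_normalForm a.1 b.1 a.2 b.2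
  | a :: b :: c :: w => by
    have ih := h.prod_eq_normalForm (b :: c :: w)
    rw [List.map_cons, List.prod_cons, ih, List.map_cons, List.map_cons, h.mul_normalForm]
    rfl

end GenericRelations

end GenericRelations

section MultihomogeneousComponents

theorem basisFreeMonoid_apply {K X : Type*} [Field K] (w : FreeMonoid X) :
    FreeAlgebra.basisFreeMonoid K X w = (w.toList.map (FreeAlgebra.ι K)).prod := by
  simp [FreeAlgebra.basisFreeMonoid, FreeAlgebra.equivMonoidAlgebraFreeMonoid,
    FreeMonoid.lift_apply]

/-- The value of a monomial, given by the multiset of its variables, as a function of the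
variables. -/
def monomialEval (K : Type*) [CommSemiring K] {P : Type*} (n : Multiset P) : (P → K) →* K where
  toFun t := (n.map t).prod
  map_one' := by simp
  map_mul' s t := Multiset.prod_map_mul

theorem monomialEval_injective (K : Type*) [CommRing K] [CharZero K] (P : Type*) :
    Function.Injective (monomialEval K (P := P)) := by
  classical
  intro m n hmn
  ext p
  have hcount (n : Multiset P) :
      monomialEval K n (Function.update (1 : P → K) p 2) = 2 ^ n.count p :=
    (Multiset.prod_map_eq_pow_single (f := Function.update (1 : P → K) p 2) p fun q hq _ =>
      Function.update_of_ne hq _ _).trans (by simp)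
  have h := DFunLike.congr_fun hmn (Function.update (1 : P → K) p 2)
  rw [hcount, hcount] at h
  exact Nat.pow_right_injective le_rfl (by exact_mod_cast h)

theorem eq_zero_of_forall_sum_monomialEval_smul {K P V : Type*} [Field K] [CharZero K]
    [AddCommGroup V] [Module K V] {f : Multiset P →₀ V}
    (hf : ∀ t : P → K, (f.sum fun n x => monomialEval K n t • x) = 0) : f = 0 := by
  ext1 n
  rw [Finsupp.zero_apply, ← Module.forall_dual_apply_eq_zero_iff K]
  intro ℓ
  have hli := (linearIndependent_monoidHom (P → K) K).comp _ (monomialEval_injective K P)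
  have h0 := linearIndependent_iff.1 hli (f.mapRange ℓ (map_zero ℓ)) <| funext fun t => by
    simpa [Finsupp.linearCombination_apply, Finsupp.sum_mapRange_index, map_finsuppSum,
      Finsupp.sum_apply', mul_comm] using congrArg ℓ (hf t)
  simpa using DFunLike.congr_fun h0 n

variable {P A : Type*} [Ring A] [Algebra ℂ A]

/-- The value at the `v i` of an element of the free algebra on symbols `(i, p)`, split according
to the multisets of the second entries `p` in its words. -/
def multidegreeValue (P : Type*) : FreeAlgebra ℂ (Fin 3 × P) →ₗ[ℂ] Multiset P →₀ M2 :=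
  (FreeAlgebra.basisFreeMonoid ℂ (Fin 3 × P)).constr ℂ fun w =>
    .single (w.toList.map Prod.snd) (w.toList.map fun a => v a.1).prod

theorem lift_eq_lsum_multidegreeValue {f : Fin 3 × P → A} {L : Multiset P → M2 →ₗ[ℂ] A}
    (hL : ∀ w : List (Fin 3 × P),
      (w.map f).prod = L (w.map Prod.snd) (w.map fun a => v a.1).prod)
    (b : FreeAlgebra ℂ (Fin 3 × P)) :
    FreeAlgebra.lift ℂ f b = Finsupp.lsum ℂ L (multidegreeValue P b) := by
  suffices h : (FreeAlgebra.lift ℂ f).toLinearMap = Finsupp.lsum ℂ L ∘ₗ multidegreeValue P from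
    LinearMap.congr_fun h b
  refine (FreeAlgebra.basisFreeMonoid ℂ (Fin 3 × P)).ext fun w => ?_
  rw [LinearMap.comp_apply, multidegreeValue, Module.Basis.constr_basis, Finsupp.lsum_single,
    ← hL, basisFreeMonoid_apply, AlgHom.toLinearMap_apply, map_list_prod, List.map_map]
  simp [Function.comp_def]

theorem GenericRelations.lift_eq {y : Fin 3 → P → A} (h : GenericRelations y)
    (b : FreeAlgebra ℂ (Fin 3 × P)) :
    FreeAlgebra.lift ℂ (fun a : Fin 3 × P => y a.1 a.2) b =
      Finsupp.lsum ℂ (fun n => normalForm y n.toList) (multidegreeValue P b) :=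
  lift_eq_lsum_multidegreeValue (fun w => by
    rw [h.prod_eq_normalForm, h.normalForm_perm
      (Multiset.coe_eq_coe.1 (Multiset.coe_toList (w.map Prod.snd : Multiset P)).symm)]) b

theorem lift_smul_v (t : P → ℂ) (b : FreeAlgebra ℂ (Fin 3 × P)) :
    FreeAlgebra.lift ℂ (fun a : Fin 3 × P => t a.2 • v a.1) b =
      Finsupp.lsum ℂ (fun n => monomialEval ℂ n t • (LinearMap.id : M2 →ₗ[ℂ] M2))
        (multidegreeValue P b) :=
  lift_eq_lsum_multidegreeValue (fun w => by
    induction w with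
    | nil => simp [monomialEval]
    | cons a w ih => simp_all [monomialEval, Function.comp_def, smul_smul, mul_comm]) b

theorem GenericRelations.lift_eq_zero {y : Fin 3 → P → A} (h : GenericRelations y)
    {b : FreeAlgebra ℂ (Fin 3 × P)}
    (hb : ∀ t : P → ℂ, FreeAlgebra.lift ℂ (fun a : Fin 3 × P => t a.2 • v a.1) b = 0) :
    FreeAlgebra.lift ℂ (fun a : Fin 3 × P => y a.1 a.2) b = 0 := by
  have hb0 : multidegreeValue P b = 0 :=
    eq_zero_of_forall_sum_monomialEval_smul fun t => (lift_smul_v t b).symm.trans (hb t)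
  rw [h.lift_eq, hb0, map_zero]

end MultihomogeneousComponents

section FreeGAlgebra

variable {G : Type*}

/-- The map `z ↦ z(xᵢ)` of `opVar` as a linear map. -/
def opVarLinear (i : ℕ) : MonoidAlgebra ℂ G →ₗ[ℂ] FreeGAlgebra G :=
  Finsupp.linearCombination ℂ (X i) ∘ₗ (MonoidAlgebra.coeffLinearEquiv ℂ).toLinearMap

theorem opVarLinear_apply (i : ℕ) (z : MonoidAlgebra ℂ G) : opVarLinear i z = opVar z i :=
  rfl

theorem X_mem_freeLie (i : ℕ) (g : G) : X i g ∈ freeLie G :=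
  LieSubalgebra.subset_lieSpan ⟨(i, g), rfl⟩

theorem map_mem_of_mem_freeLie {A : Type*} [Ring A] [Algebra ℂ A] {θ : FreeGAlgebra G →ₐ[ℂ] A}
    {K : LieSubalgebra ℂ A} (h : ∀ i g, θ (X i g) ∈ K) {f : FreeGAlgebra G}
    (hf : f ∈ freeLie G) : θ f ∈ K := by
  suffices hle : freeLie G ≤ K.comap θ.toLieHom from hle hf
  refine LieSubalgebra.lieSpan_le.2 ?_
  rintro _ ⟨⟨i, g⟩, rfl⟩
  exact h i g

theorem algHom_ext_X {A : Type*} [Semiring A] [Algebra ℂ A] {θ η : FreeGAlgebra G →ₐ[ℂ] A}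
    (h : ∀ i g, θ (X i g) = η (X i g)) : θ = η :=
  FreeAlgebra.hom_ext (funext fun p => h p.1 p.2)

variable [Group G]

theorem opVarLinear_of (i : ℕ) (g : G) : opVarLinear i (MonoidAlgebra.of ℂ G g) = X i g := by
  simp [opVarLinear]

theorem gAct_X (g : G) (i : ℕ) (h : G) : gAct g (X i h) = X i (g * h) := by
  simp [gAct]

section Evaluation

variable (φ : G →* (M2 ≃ₐ[ℂ] M2)) (a : ℕ → M2)

theorem eval_X (i : ℕ) (g : G) : eval φ a (X i g) = φ g (a i) := by
  simp [eval]

theorem groupAlgebraAct_of (g : G) (x : M2) :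
    groupAlgebraAct φ (MonoidAlgebra.of ℂ G g) x = φ g x := by
  simp [groupAlgebraAct]

theorem eval_opVar (z : MonoidAlgebra ℂ G) (i : ℕ) :
    eval φ a (opVar z i) = groupAlgebraAct φ z (a i) := by
  rw [← opVarLinear_apply]
  induction z using MonoidAlgebra.induction_on with
  | of g => rw [opVarLinear_of, groupAlgebraAct_of, eval_X]
  | add y z hy hz => simp only [map_add, hy, hz, LinearMap.add_apply]
  | smul c z hz => simp only [map_smul, hz, LinearMap.smul_apply]

theorem eval_gAct (g : G) (f : FreeGAlgebra G) : eval φ a (gAct g f) = φ g (eval φ a f) := by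
  suffices h : (eval φ a).comp (gAct g) = (φ g : M2 →ₐ[ℂ] M2).comp (eval φ a) from
    AlgHom.congr_fun h f
  refine algHom_ext_X fun i h => ?_
  simp [gAct_X, eval_X]

theorem eval_comp {θ : FreeGAlgebra G →ₐ[ℂ] FreeGAlgebra G}
    (hθ : ∀ g f, θ (gAct g f) = gAct g (θ f)) :
    (eval φ a).comp θ = eval φ fun i => eval φ a (θ (X i 1)) := by
  refine algHom_ext_X fun i g => ?_
  rw [AlgHom.comp_apply, eval_X, ← eval_gAct, ← hθ, gAct_X, mul_one]

theorem eval_mem_sl2 {a : ℕ → M2} (ha : ∀ i, a i ∈ sl2) {f : FreeGAlgebra G}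
    (hf : f ∈ freeLie G) : eval φ a f ∈ sl2 := by
  refine map_mem_of_mem_freeLie (fun i g => ?_) hf
  rw [eval_X, ← groupAlgebraAct_of]
  exact groupAlgebraAct_mem_sl2 φ _ (ha i)

theorem isWeakGIdeal_weakIdentities : IsWeakGIdeal (weakIdentities φ) := by
  intro θ hθ f hf
  rw [mem_weakIdentities] at hf ⊢
  intro a ha
  rw [← AlgHom.comp_apply, eval_comp φ a hθ.1]
  exact hf _ fun i => eval_mem_sl2 φ ha (hθ.2 _ (X_mem_freeLie i 1))

end Evaluation

/-- The endomorphism of the free `G`-algebra that commutes with the action of `G` and replaces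
`xᵢ` by the variable `τ i`. -/
def substVar (τ : ℕ → ℕ × G) : FreeGAlgebra G →ₐ[ℂ] FreeGAlgebra G :=
  FreeAlgebra.lift ℂ fun p => X (τ p.1).1 (p.2 * (τ p.1).2)

theorem substVar_X (τ : ℕ → ℕ × G) (i : ℕ) (g : G) :
    substVar τ (X i g) = X (τ i).1 (g * (τ i).2) := by
  simp [substVar]

theorem substVar_opVar (τ : ℕ → ℕ × G) (z : MonoidAlgebra ℂ G) (i : ℕ) :
    substVar τ (opVar z i) = opVar (z * MonoidAlgebra.of ℂ G (τ i).2) (τ i).1 := by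
  simp only [← opVarLinear_apply]
  induction z using MonoidAlgebra.induction_on with
  | of g => rw [← map_mul, opVarLinear_of, opVarLinear_of, substVar_X]
  | add y z hy hz => simp only [map_add, add_mul, hy, hz]
  | smul c z hz => simp only [map_smul, smul_mul_assoc, hz]

theorem isPairEndomorphism_substVar (τ : ℕ → ℕ × G) : IsPairEndomorphism (substVar τ) := by
  refine ⟨fun g f => ?_, fun f hf => map_mem_of_mem_freeLie (fun i g => ?_) hf⟩
  · suffices h : (substVar τ).comp (gAct g) = (gAct g).comp (substVar τ) from
      AlgHom.congr_fun h f
    refine algHom_ext_X fun i h => ?_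
    simp only [AlgHom.comp_apply, gAct_X, substVar_X, mul_assoc]
  · rw [substVar_X]
    exact X_mem_freeLie _ _

end FreeGAlgebra

section Quotient

variable {G : Type*} {I : TwoSidedIdeal (FreeGAlgebra G)}

/-- The quotient of `ℂ⟨X; G⟩` by a two-sided ideal, as a homomorphism of algebras. -/
def quotientMap (I : TwoSidedIdeal (FreeGAlgebra G)) : FreeGAlgebra G →ₐ[ℂ] I.ringCon.Quotient :=
  RingCon.mkₐ ℂ I.ringCon

theorem quotientMap_eq_zero_iff {f : FreeGAlgebra G} : quotientMap I f = 0 ↔ f ∈ I := by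
  conv_rhs => rw [← TwoSidedIdeal.ker_ringCon_mk' I, TwoSidedIdeal.mem_ker]
  rfl

variable [Group G] {φ : G →* (M2 ≃ₐ[ℂ] M2)} {ε : Fin 3 → Fin 3 → MonoidAlgebra ℂ G}

theorem genericRelations_quotientMap (hI : IsWeakGIdeal I) (hε : ∀ f, IsListed ε f → f ∈ I) :
    GenericRelations fun (i : Fin 3) (p : ℕ × Fin 3) => quotientMap I (opVar (ε i p.2) p.1) := by
  let θ (m n r : ℕ) : FreeGAlgebra G →ₐ[ℂ] FreeGAlgebra G :=
    substVar fun i => (if i = 1 then m else if i = 2 then n else r, 1)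
  have hθ (m n r : ℕ) (z : MonoidAlgebra ℂ G) (i : ℕ) :
      θ m n r (opVar z i) = opVar z (if i = 1 then m else if i = 2 then n else r) := by
    rw [substVar_opVar, map_one, mul_one]
  have hq (m n r : ℕ) {f : FreeGAlgebra G} (hf : IsListed ε f) : quotientMap I (θ m n r f) = 0 :=
    quotientMap_eq_zero_iff.2 (hI _ (isPairEndomorphism_substVar _) f (hε f hf))
  constructor
  case comm =>
    intro p q
    simpa [hθ, sub_eq_zero] using hq p.1 q.1 0 (.two p.2 q.2)
  case anticomm =>
    intro i hi p q
    simpa [hθ, eq_neg_iff_add_eq_zero, add_comm] using hq q.1 p.1 0 (.three q.2 i p.2 hi)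
  case triple =>
    intro i j hi hj hij p q r
    simpa [hθ, sub_eq_zero] using hq p.1 q.1 r.1 (.four i j p.2 q.2 r.2 hi hj hij)
  case sq =>
    intro i hi p q
    simpa [hθ] using hq p.1 q.1 0 (.five i p.2 q.2 hi)
  case add =>
    intro p q
    simpa [hθ, sub_eq_zero] using hq p.1 q.1 0 (.six p.2 q.2)
  case swap_zero =>
    intro j hj p q
    simpa [hθ, sub_eq_zero] using hq p.1 q.1 0 (.seven j p.2 q.2 hj)
  case swap_one_two =>
    intro p q
    simpa [hθ, sub_eq_zero] using hq p.1 q.1 0 (.eight p.2 q.2)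

/-- The variables `xₘ^g` written in terms of new variables `(i, (m, j))`, which stand for the
elements `εᵢⱼ(xₘ)`. -/
def toEpsilonVars (φ : G →* (M2 ≃ₐ[ℂ] M2)) :
    FreeGAlgebra G →ₐ[ℂ] FreeAlgebra ℂ (Fin 3 × (ℕ × Fin 3)) :=
  FreeAlgebra.lift ℂ fun p => ∑ i, ∑ j, coord i (φ p.2 (v j)) • FreeAlgebra.ι ℂ (i, (p.1, j))

theorem lift_toEpsilonVars_X {A : Type*} [Ring A] [Algebra ℂ A] (y : Fin 3 × (ℕ × Fin 3) → A)
    (m : ℕ) (g : G) :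
    FreeAlgebra.lift ℂ y (toEpsilonVars φ (X m g)) =
      ∑ i, ∑ j, coord i (φ g (v j)) • y (i, (m, j)) := by
  simp [toEpsilonVars]

theorem lift_smul_v_comp_toEpsilonVars (t : ℕ × Fin 3 → ℂ) :
    (FreeAlgebra.lift ℂ fun a : Fin 3 × (ℕ × Fin 3) => t a.2 • v a.1).comp (toEpsilonVars φ) =
      eval φ fun m => ∑ j, t (m, j) • v j := by
  refine algHom_ext_X fun m g => ?_
  have hv (j : Fin 3) : ∑ i, coord i (φ g (v j)) • v i = φ g (v j) := by
    rw [← groupAlgebraAct_of]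
    exact sum_coord_smul_v (groupAlgebraAct_mem_sl2 φ _ (v_mem_sl2 j))
  rw [AlgHom.comp_apply, lift_toEpsilonVars_X, eval_X, Finset.sum_comm]
  simp only [map_sum, map_smul, smul_comm _ (t _), ← Finset.smul_sum, hv]

theorem IsEpsilon.lift_comp_toEpsilonVars (h : IsEpsilon φ ε) (hI : IsWeakGIdeal I)
    (hε : ∀ f, IsListed ε f → f ∈ I) :
    (FreeAlgebra.lift ℂ fun a : Fin 3 × (ℕ × Fin 3) =>
      quotientMap I (opVar (ε a.1 a.2.2) a.2.1)).comp (toEpsilonVars φ) = quotientMap I := by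
  refine algHom_ext_X fun m g => ?_
  have hone := hI _ (isPairEndomorphism_substVar fun _ => (m, g)) _ (hε _ .one)
  rw [← quotientMap_eq_zero_iff, map_sub, map_sub, sub_eq_zero, substVar_X, one_mul] at hone
  rw [AlgHom.comp_apply, lift_toEpsilonVars_X, ← hone]
  simp only [map_add, substVar_opVar, h.mul_right_eq_sum, groupAlgebraAct_of]
  simp only [← opVarLinear_apply, map_sum, map_smul]
  exact Fin.sum_univ_three _

end Quotient

section Basis

variable {G : Type*} [Group G] {φ : G →* (M2 ≃ₐ[ℂ] M2)} {ε : Fin 3 → Fin 3 → MonoidAlgebra ℂ G}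

theorem IsEpsilon.mem_weakIdentities_of_isListed (h : IsEpsilon φ ε) {f : FreeGAlgebra G}
    (hf : IsListed ε f) : f ∈ weakIdentities φ := by
  rw [mem_weakIdentities]
  intro a ha
  have he (i α : Fin 3) (m : ℕ) : eval φ a (opVar (ε i α) m) = coord α (a m) • v i := by
    rw [eval_opVar, h.apply i α (ha m)]
  have hr := genericRelations_smul_v fun p : ℕ × Fin 3 => coord p.2 (a p.1)
  cases hf with
  | one =>
    rw [map_sub, map_add, map_add, he, he, he, eval_X, map_one, AlgEquiv.one_apply,
      ← Fin.sum_univ_three (f := fun i => coord i (a 1) • v i), sum_coord_smul_v (ha 1), sub_self]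
  | two α β =>
    simpa only [map_sub, map_mul, he, sub_eq_zero] using hr.comm (1, α) (2, β)
  | three α i j hi =>
    simpa only [map_add, map_mul, he, add_comm, eq_neg_iff_add_eq_zero] using
      hr.anticomm i hi (2, j) (1, α)
  | four i j α β γ hi hj hij =>
    simpa only [map_sub, map_mul, he, sub_eq_zero] using
      hr.triple i j hi hj hij (1, α) (2, β) (3, γ)
  | five i α β hi =>
    simpa only [map_mul, he] using hr.sq i hi (1, α) (2, β)
  | six α β =>
    simpa only [map_sub, map_add, map_mul, he, sub_eq_zero] using hr.add (1, α) (2, β)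
  | seven j α β hj =>
    simpa only [map_sub, map_mul, he, sub_eq_zero] using hr.swap_zero j hj (1, α) (2, β)
  | eight α β =>
    simpa only [map_sub, map_mul, he, sub_eq_zero] using hr.swap_one_two (1, α) (2, β)

theorem IsEpsilon.isBasisOfWeakIdentities (h : IsEpsilon φ ε) :
    IsBasisOfWeakIdentities φ {f | IsListed ε f} := by
  refine ⟨⟨isWeakGIdeal_weakIdentities φ, fun f => h.mem_weakIdentities_of_isListed⟩, ?_⟩
  rintro I ⟨hI, hε⟩ f hf
  rw [← quotientMap_eq_zero_iff, ← h.lift_comp_toEpsilonVars hI fun _ hg => hε hg,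
    AlgHom.comp_apply]
  refine (genericRelations_quotientMap hI fun _ hg => hε hg).lift_eq_zero fun t => ?_
  rw [← AlgHom.comp_apply, lift_smul_v_comp_toEpsilonVars]
  exact (mem_weakIdentities φ f).1 hf _ fun m =>
    sum_mem fun j _ => sl2.smul_mem _ (v_mem_sl2 j)

theorem isIrreducible_sl2Rep
    (hG : Nonempty (G ≃* alternatingGroup (Fin 4)) ∨ Nonempty (G ≃* alternatingGroup (Fin 5)) ∨
      Nonempty (G ≃* Equiv.Perm (Fin 4))) (hφ : Function.Injective φ) :
    (sl2Rep φ).IsIrreducible := by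
  obtain ⟨a, b, c, h, ha⟩ := exists_isKleinTriple hG
  refine isIrreducible_of_isKleinTriple h ?_ ((map_ne_one_iff _ (sl2Rep_injective hφ)).2 ha)
  rw [Module.finrank_eq_card_basis sl2Basis, Fintype.card_fin]

end Basis

end

end WeakGIdentities

theorem mainTheorem4_general {G : Type*} [Group G] [Finite G]
    (φ : G →* (WeakGIdentities.M2 ≃ₐ[ℂ] WeakGIdentities.M2))
    (hφ : (WeakGIdentities.sl2Rep φ).IsIrreducible) :
    (∃! ε : Fin 3 → Fin 3 → MonoidAlgebra ℂ G, WeakGIdentities.IsEpsilon φ ε) ∧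
    ∀ ε : Fin 3 → Fin 3 → MonoidAlgebra ℂ G, WeakGIdentities.IsEpsilon φ ε →
      (∀ i j k l, ε i j * ε k l = if j = k then ε i l else 0) ∧
      WeakGIdentities.IsBasisOfWeakIdentities φ {f | WeakGIdentities.IsListed ε f} :=
  ⟨WeakGIdentities.existsUnique_isEpsilon hφ,
    fun _ hε => ⟨hε.mul_eq, hε.isBasisOfWeakIdentities⟩⟩

theorem mainTheorem4 {G : Type*} [Group G]
    (hG : Nonempty (G ≃* alternatingGroup (Fin 4)) ∨ Nonempty (G ≃* alternatingGroup (Fin 5)) ∨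
      Nonempty (G ≃* Equiv.Perm (Fin 4)))
    (φ : G →* (WeakGIdentities.M2 ≃ₐ[ℂ] WeakGIdentities.M2)) (hφ : Function.Injective φ) :
    (∃! ε : Fin 3 → Fin 3 → MonoidAlgebra ℂ G, WeakGIdentities.IsEpsilon φ ε) ∧
    ∀ ε : Fin 3 → Fin 3 → MonoidAlgebra ℂ G, WeakGIdentities.IsEpsilon φ ε →
      (∀ i j k l, ε i j * ε k l = if j = k then ε i l else 0) ∧
      WeakGIdentities.IsBasisOfWeakIdentities φ {f | WeakGIdentities.IsListed ε f} :=
  have := WeakGIdentities.finite_of_mulEquiv hG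
  mainTheorem4_general φ (WeakGIdentities.isIrreducible_sl2Rep hG hφ)
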